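/- Let $\mathcal C$ be a combinatorial class, that is, a set with a size function $|\cdot|:\mathcal C\to\{1,2,\dots\}$ such that $c_k:=|\{C\in\mathcal C:|C|=k\}|$ is finite for every $k$, and let $C(x)=\sum_{k\ge1}c_kx^k$. Assume that $C(x)$ is subexponential with radius of convergence $\rho>0$: as $n\to\infty$, $c_{n-1}/c_n\to\rho$ and $\frac1{c_n}\sum_{0\le k\le n}c_kc_{n-k}\to 2C(\rho)<\infty$ (where $c_0=0$). Let $m=\min\{k:c_k>0\}$. For a finite multiset $G$ of elements of $\mathcal C$, let $|G|$ be the sum of the sizes of its elements and $\kappa(G)$ their number, both counted with multiplicity. Let $\mathcal G_{n,N}$ be the set of the multisets $G$ with $|G|=n$ and $\kappa(G)=N$, and let $\mathsf G_{n,N}$ be uniformly distributed on $\mathcal G_{n,N}$. The remainder $\mathcal R(G)$ of $G$ is obtained by removing one copy of an element of largest size (chosen by any fixed rule) and all elements of size $m$. Let $\mathcal C_{>m}$ be the set of all $C\in\mathcal C$ with $|C|>m$, and $\mathrm{Mset}(\mathcal C_{>m})$ the set of all finite multisets of elements of $\mathcal C_{>m}$, the empty one included. Then, as $n$, $N$ and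 $n-mN$ all tend to infinity, $\mathcal G_{n,N}$ is eventually nonempty and $\mathcal R(\mathsf G_{n,N})$ converges in distribution (on the discrete space $\mathrm{Mset}(\mathcal C_{>m})$) to the random multiset $\Gamma G_{>m}(\rho)$ with the Boltzmann law $$\Pr[\Gamma G_{>m}(\rho)=G]=\exp\Bigl(-\sum_{j\ge1}\frac{C(\rho^j)-c_m\rho^{jm}}{j\,\rho^{jm}}\Bigr)\,\rho^{|G|-m\kappa(G)},\qquad G\in\mathrm{Mset}(\mathcal C_{>m}),$$ which is a probability distribution. -/

import Mathlib

open Filter Topology MeasureTheory ProbabilityTheory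

universe u

noncomputable section

/-- A combinatorial class: a type of objects, each with a size in `{1, 2, ...}`,
such that there are only finitely many objects of every given size. -/
structure CombClass where
  /-- The objects of the class. -/
  Obj : Type u
  /-- The size of an object. -/
  size : Obj → ℕ
  size_pos : ∀ c, 0 < size c
  finite_size_eq : ∀ k, {c | size c = k}.Finite

namespace CombClass

/-- The number `c_k` of objects of size `k`. -/
def count (C : CombClass.{u}) (k : ℕ) : ℕ := {c | C.size c = k}.ncard

/-- The value `C(x) = ∑ c_k x ^ k` of the generating series. -/
def genSeries (C : CombClass.{u}) (x : ℝ) : ℝ := ∑' k, (C.count k : ℝ) * x ^ k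

/-- The class `C_{>m}` of the objects of size larger than `m`, with size function `|c| - m`. -/
def above (C : CombClass.{u}) (m : ℕ) : CombClass.{u} where
  Obj := {c : C.Obj // m < C.size c}
  size c := C.size c.1 - m
  size_pos c := Nat.sub_pos_of_lt c.2
  finite_size_eq k := by
    refine Set.Finite.of_finite_image (f := Subtype.val)
      ((C.finite_size_eq (k + m)).subset ?_) Subtype.val_injective.injOn
    rintro _ ⟨c, hc, rfl⟩
    have h1 := c.2
    simp only [Set.mem_ofPred_eq] at hc ⊢
    omega

/-- An object of `C_{>m}`, as an object of `C`. -/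
def ofAbove (C : CombClass.{u}) (m : ℕ) (c : (C.above m).Obj) : C.Obj := c.1

/-- An object of `C` of size larger than `m`, as an object of `C_{>m}`. -/
def toAbove (C : CombClass.{u}) (m : ℕ) (c : C.Obj) (h : m < C.size c) : (C.above m).Obj := ⟨c, h⟩

/-- The finite multisets of objects of `C` (the empty multiset included). -/
abbrev Mset (C : CombClass.{u}) : Type u := Multiset C.Obj

/-- The set of multisets over `C` is a discrete space. -/
instance (C : CombClass.{u}) : TopologicalSpace C.Mset := ⊥

instance (C : CombClass.{u}) : DiscreteTopology C.Mset := ⟨rfl⟩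

instance (C : CombClass.{u}) : MeasurableSpace C.Mset := ⊤

instance (C : CombClass.{u}) : DiscreteMeasurableSpace C.Mset := ⟨fun _ => trivial⟩

/-- The size `|G|` of a multiset, counted with multiplicities. The number of components `κ(G)`
is `Multiset.card G`. -/
def msize (C : CombClass.{u}) (G : C.Mset) : ℕ := (G.map C.size).sum

/-- The set `G_{n,N}` of the multisets of size `n` with `N` components. -/
def msets (C : CombClass.{u}) (n N : ℕ) : Set C.Mset := {G | C.msize G = n ∧ Multiset.card G = N}

lemma finite_msets (C : CombClass.{u}) (n N : ℕ) : (C.msets n N).Finite := by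
  classical
  have hfin : {c | C.size c ≤ n}.Finite := by
    have : {c | C.size c ≤ n} = ⋃ k ∈ Finset.range (n + 1), {c | C.size c = k} := by
      ext c; simp
    rw [this]
    exact Set.Finite.biUnion (Finset.finite_toSet _) fun k _ => C.finite_size_eq k
  refine Set.Finite.subset (Set.finite_range
    (fun s : Sym {c // c ∈ hfin.toFinset} N => s.1.map Subtype.val)) ?_
  rintro G ⟨h1, h2⟩
  have hmem : ∀ c ∈ G, c ∈ hfin.toFinset := fun c hc => by
    have := Multiset.single_le_sum (fun _ _ => Nat.zero_le _) _ (Multiset.mem_map_of_mem C.size hc)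
    simp only [Set.Finite.mem_toFinset, Set.mem_ofPred_eq]
    exact this.trans_eq h1
  refine ⟨⟨G.attach.map fun c => ⟨c.1, hmem c.1 c.2⟩, by simp [h2]⟩, ?_⟩
  simp [Multiset.map_map]

open Classical in
/-- The law of `𝖦_{n,N}` as a measure: the uniform distribution on the finite set `G_{n,N}`. (Where
`G_{n,N}` is empty there is no such law; the value is then the point mass at the empty multiset.) -/
def uniformMeasure (C : CombClass.{u}) (n N : ℕ) : Measure C.Mset :=
  if (C.msets n N).Nonempty then uniformOn (C.msets n N) else Measure.dirac 0

instance (C : CombClass.{u}) (n N : ℕ) : IsProbabilityMeasure (C.uniformMeasure n N) := by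
  unfold uniformMeasure
  split_ifs with h
  · exact isProbabilityMeasure_uniformOn (C.finite_msets n N) h
  · infer_instance

/-- The law of `𝖦_{n,N}`. -/
def uniformLaw (C : CombClass.{u}) (n N : ℕ) : ProbabilityMeasure C.Mset :=
  ⟨C.uniformMeasure n N, inferInstance⟩

/-- `pick` selects a component of largest size in every nonempty multiset. -/
def IsLargestChoice (C : CombClass.{u}) (pick : C.Mset → C.Obj) : Prop :=
  ∀ G, G ≠ 0 → pick G ∈ G ∧ ∀ c ∈ G, C.size c ≤ C.size (pick G)

open Classical in
/-- The remainder of `G`: lower the multiplicity of the selected component by one and keep, of what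
is left, the components of size larger than `m`. -/
def remainder (C : CombClass.{u}) (m : ℕ) (pick : C.Mset → C.Obj) (G : C.Mset) : (C.above m).Mset :=
  (G.erase (pick G)).filterMap fun c => if h : m < C.size c then some (C.toAbove m c h) else none

/-- The law of the remainder of `𝖦_{n,N}`. -/
def remainderLaw (C : CombClass.{u}) (m : ℕ) (pick : C.Mset → C.Obj) (n N : ℕ) :
    ProbabilityMeasure (C.above m).Mset :=
  (C.uniformLaw n N).map (f := C.remainder m pick) (Measurable.of_discrete).aemeasurable

/-- The value `exp (∑_{j ≥ 1} C(x ^ j) / j)` of the generating series of the multisets over `C`. -/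
def msetSeries (C : CombClass.{u}) (x : ℝ) : ℝ :=
  Real.exp (∑' j : ℕ, C.genSeries (x ^ (j + 1)) / (j + 1))

/-- `P` is the Boltzmann distribution with parameter `x` on the multisets over `C`. -/
def IsBoltzmann (C : CombClass.{u}) (x : ℝ) (P : ProbabilityMeasure C.Mset) : Prop :=
  ∀ G : C.Mset, (P : Measure C.Mset).real {G} = x ^ C.msize G / C.msetSeries x

end CombClass

/-- The non-negative sequence `c` is subexponential with radius of convergence `ρ`. -/
structure IsSubexponential (c : ℕ → ℝ) (ρ : ℝ) : Prop where
  nonneg : ∀ k, 0 ≤ c k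
  radius_pos : 0 < ρ
  ratio : Tendsto (fun n => c n / c (n + 1)) atTop (𝓝 ρ)
  summable : Summable fun k => c k * ρ ^ k
  conv : Tendsto (fun n => (∑ k ∈ Finset.range (n + 1), c k * c (n - k)) / c n) atTop
    (𝓝 (2 * ∑' k, c k * ρ ^ k))

end

/-! ### Generating series as sums over objects, and the Euler product for multisets. -/

open scoped ENNReal

/-! Put `r = n - m * N` and give each object `c` of `C_{>m}` the reduced size `|c| - m`. Every
multiset in `G_{n,N}` splits into components of size `m` and a multiset over `C_{>m}` of total
reduced size `r`. Let `d` count the objects of `C_{>m}` and `g` the multisets over `C_{>m}`, both by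
reduced size, let `b K` count the multisets of `K` objects of size `m`, and let `S = ∑ g i * ρ ^ i`.

Padding with a fixed object of size `m` gives `|G_{n,N}| ≤ g r * b N` (`ncard_msets_le`).
Conversely, for a fixed `H` of reduced size `h` with `k` components, adjoining one object of reduced
size `r - h` and `N - k - 1` objects of size `m` produces `d (r - h) * b (N - k - 1)` multisets with
remainder `H` (`le_ncard_remainder_eq`). Since `b` is polynomial and `d` has ratio limit `ρ`, the
probability of `H` is asymptotically at least `ρ ^ h / S` as soon as `g r ≤ (S + ε) * d r`
eventually. No upper bound on the probability is needed: the values `ρ ^ h / S` sum to one, so no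
mass can escape (`PMF.tendsto_toMeasure_of_forall_lt`).

The bound on `g` is where subexponentiality enters (`eventually_le_mul_of_le_convolution`). A
multiset either has only components of reduced size at most `K`, which leaves polynomially many, or
loses one larger component, which bounds `g` by a convolution of `g` and `d`. Small remainders
contribute at most about `S * d n`; the middle range is negligible because it is so for `d` with
itself. -/

lemma ENNReal.tsum_pow_eq_tsum_ncard {β : Type*} (size : β → ℕ)
    (hfin : ∀ k, {b | size b = k}.Finite) (y : ℝ≥0∞) :
    ∑' b, y ^ size b = ∑' k, ({b | size b = k}.ncard : ℝ≥0∞) * y ^ k := by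
  rw [← ENNReal.tsum_fiberwise _ size]
  refine tsum_congr fun k => ?_
  have h : ∀ b : (size ⁻¹' {k} : Set β), y ^ size b = y ^ k := fun b => by
    rw [show size b = k from b.2]
  rw [tsum_congr h, ENNReal.tsum_set_const]
  congr 1
  change (({b | size b = k}.encard : ℕ∞) : ℝ≥0∞) = _
  rw [← (hfin k).cast_ncard_eq]
  rfl

lemma tsum_pow_eq_tsum_ncard {β : Type*} (size : β → ℕ)
    (hfin : ∀ k, {b | size b = k}.Finite) {y : ℝ} (hy : 0 ≤ y) :
    ∑' b, y ^ size b = ∑' k, ({b | size b = k}.ncard : ℝ) * y ^ k := by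
  have h := congrArg ENNReal.toReal (ENNReal.tsum_pow_eq_tsum_ncard size hfin (ENNReal.ofReal y))
  rw [ENNReal.tsum_toReal_eq (by finiteness), ENNReal.tsum_toReal_eq (by finiteness)] at h
  simpa [hy] using h

lemma summable_pow_iff_summable_ncard {β : Type*} (size : β → ℕ)
    (hfin : ∀ k, {b | size b = k}.Finite) {y : ℝ} (hy : 0 ≤ y) :
    (Summable fun b => y ^ size b) ↔ Summable fun k => ({b | size b = k}.ncard : ℝ) * y ^ k := by
  have h := ENNReal.tsum_pow_eq_tsum_ncard size hfin (ENNReal.ofReal y)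
  have h1 : ∀ b, ENNReal.ofReal y ^ size b = ENNReal.ofReal (y ^ size b) := fun b =>
    (ENNReal.ofReal_pow hy _).symm
  have h2 : ∀ k, ({b | size b = k}.ncard : ℝ≥0∞) * ENNReal.ofReal y ^ k =
      ENNReal.ofReal (({b | size b = k}.ncard : ℝ) * y ^ k) := fun k => by
    rw [ENNReal.ofReal_mul (by positivity), ENNReal.ofReal_pow hy, ENNReal.ofReal_natCast]
  simp only [h1, h2] at h
  constructor <;> intro hs
  · have := hs.tsum_ofReal_ne_top
    rw [h] at this
    have := ENNReal.summable_toReal this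
    exact this.congr fun k => ENNReal.toReal_ofReal (by positivity)
  · have := hs.tsum_ofReal_ne_top
    rw [← h] at this
    have := ENNReal.summable_toReal this
    exact this.congr fun k => ENNReal.toReal_ofReal (by positivity)

/-- A multiset over `insert a S` is a multiplicity of `a` together with a multiset over `S`, so each
new object contributes a geometric series. In `ℝ≥0∞` this needs no convergence hypothesis. -/
lemma tsum_multiset_subtype_eq_prod {α : Type*} (f : α → ℝ≥0∞) (S : Finset α) :
    ∑' H : {H : Multiset α // ∀ c ∈ H, c ∈ S}, (H.1.map f).prod = ∏ c ∈ S, (1 - f c)⁻¹ := by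
  classical
  induction S using Finset.induction_on with
  | empty =>
    have : Unique {H : Multiset α // ∀ c ∈ H, c ∈ (∅ : Finset α)} :=
      { default := ⟨0, by simp⟩
        uniq := fun H => Subtype.ext (Multiset.eq_zero_of_forall_notMem fun c hc => by
          simpa using H.2 c hc) }
    rw [tsum_fintype, Fintype.sum_unique]
    simp [Subsingleton.elim default (⟨0, by simp⟩ : {H : Multiset α // ∀ c ∈ H, c ∈ (∅ : Finset α)})]
  | insert a S ha ih =>
    let e : ℕ × {H : Multiset α // ∀ c ∈ H, c ∈ S} ≃
        {H : Multiset α // ∀ c ∈ H, c ∈ insert a S} :=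
      { toFun := fun p => ⟨Multiset.replicate p.1 a + p.2.1, fun c hc => by
          rcases Multiset.mem_add.1 hc with h | h
          · simp [Multiset.eq_of_mem_replicate h]
          · simp [p.2.2 c h]⟩
        invFun := fun H => (H.1.count a, ⟨H.1.filter fun c => ¬ c = a, fun c hc => by
          have h := Multiset.mem_filter.1 hc
          simpa [h.2] using H.2 c h.1⟩)
        left_inv := fun p => by
          have h0 : a ∉ p.2.1 := fun h => ha (p.2.2 a h)
          ext1
          · simp [Multiset.count_eq_zero_of_notMem h0]
          · ext1
            have h1 : (p.2.1.filter fun c => ¬ c = a) = p.2.1 :=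
              Multiset.filter_eq_self.2 fun c hc hca => h0 (hca ▸ hc)
            have h2 : (Multiset.replicate p.1 a).filter (fun c => ¬ c = a) = 0 :=
              Multiset.filter_eq_nil.2 fun c hc => by simp [Multiset.eq_of_mem_replicate hc]
            simp [h1, h2]
        right_inv := fun H => by
          ext1
          change Multiset.replicate (H.1.count a) a + H.1.filter (fun c => ¬ c = a) = H.1
          rw [← Multiset.filter_eq', Multiset.filter_add_not] }
    rw [← e.tsum_eq, ENNReal.tsum_prod', Finset.prod_insert ha, ← ih, ← ENNReal.tsum_geometric,
      ← ENNReal.tsum_mul_right]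
    refine tsum_congr fun n => ?_
    rw [← ENNReal.tsum_mul_left]
    refine tsum_congr fun H => ?_
    simp [e]

lemma multiset_prod_map_nonneg {α : Type*} {f : α → ℝ} (h0 : ∀ c, 0 ≤ f c) (H : Multiset α) :
    0 ≤ (H.map f).prod :=
  Multiset.prod_nonneg fun x hx => by
    obtain ⟨c, -, rfl⟩ := Multiset.mem_map.1 hx
    exact h0 c

lemma hasSum_multiset_subtype_prod {α : Type*} {f : α → ℝ} (h0 : ∀ c, 0 ≤ f c)
    (h1 : ∀ c, f c < 1) (S : Finset α) :
    HasSum (fun H : {H : Multiset α // ∀ c ∈ H, c ∈ S} => (H.1.map f).prod)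
      (Real.exp (∑ c ∈ S, -Real.log (1 - f c))) := by
  have hpos := multiset_prod_map_nonneg h0
  have h := tsum_multiset_subtype_eq_prod (fun c => ENNReal.ofReal (f c)) S
  have hl : ∀ H : Multiset α, (H.map fun c => ENNReal.ofReal (f c)).prod =
      ENNReal.ofReal (H.map f).prod := fun H => by
    induction H using Multiset.induction_on with
    | empty => simp
    | cons a H ih => simp [ih, ENNReal.ofReal_mul (h0 a)]
  have hr : ∏ c ∈ S, (1 - ENNReal.ofReal (f c))⁻¹ =
      ENNReal.ofReal (Real.exp (∑ c ∈ S, -Real.log (1 - f c))) := by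
    rw [Real.exp_sum, ENNReal.ofReal_prod_of_nonneg fun _ _ => (Real.exp_pos _).le]
    refine Finset.prod_congr rfl fun c _ => ?_
    have hc : 0 < 1 - f c := sub_pos.2 (h1 c)
    rw [Real.exp_neg, Real.exp_log hc, ENNReal.ofReal_inv_of_pos hc, ENNReal.ofReal_sub _ (h0 c),
      ENNReal.ofReal_one]
  rw [hr] at h
  simp only [hl] at h
  have hne : ∑' H : {H : Multiset α // ∀ c ∈ H, c ∈ S}, ENNReal.ofReal (H.1.map f).prod ≠ ∞ := by
    rw [h]; exact ENNReal.ofReal_ne_top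
  have hsum : Summable fun H : {H : Multiset α // ∀ c ∈ H, c ∈ S} => (H.1.map f).prod :=
    (ENNReal.summable_toReal hne).congr fun H => ENNReal.toReal_ofReal (hpos H.1)
  have h' := congrArg ENNReal.toReal h
  rw [ENNReal.tsum_toReal_eq fun _ => ENNReal.ofReal_ne_top,
    ENNReal.toReal_ofReal (Real.exp_pos _).le] at h'
  refine hsum.hasSum_iff.2 (Eq.trans ?_ h')
  exact tsum_congr fun H => (ENNReal.toReal_ofReal (hpos H.1)).symm

/-- The Euler product of the multisets over `α`. -/
lemma hasSum_multiset_prod {α : Type*} {f : α → ℝ} (h0 : ∀ c, 0 ≤ f c) (h1 : ∀ c, f c < 1) {s : ℝ}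
    (hs : HasSum (fun c => -Real.log (1 - f c)) s) :
    HasSum (fun H : Multiset α => (H.map f).prod) (Real.exp s) := by
  classical
  have hpos := multiset_prod_map_nonneg h0
  have hnn : ∀ c, 0 ≤ -Real.log (1 - f c) := fun c =>
    neg_nonneg.2 (Real.log_nonpos (by linarith [h1 c]) (by linarith [h0 c]))
  have hupper : ∀ T : Finset (Multiset α), ∑ H ∈ T, (H.map f).prod ≤ Real.exp s := fun T => by
    -- Finitely many multisets involve only finitely many objects, so the finite Euler product
    -- bounds every partial sum.
    obtain ⟨S, hS⟩ : ∃ S : Finset α, ∀ H ∈ T, ∀ c ∈ H, c ∈ S :=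
      ⟨T.biUnion fun H => H.toFinset, fun H hH c hc =>
        Finset.mem_biUnion.2 ⟨H, hH, Multiset.mem_toFinset.2 hc⟩⟩
    rw [← Finset.sum_subtype_of_mem (fun H => (H.map f).prod) hS]
    exact (sum_le_hasSum _ (fun H _ => hpos H.1) (hasSum_multiset_subtype_prod h0 h1 S)).trans
      (Real.exp_le_exp.2 (sum_le_hasSum _ (fun c _ => hnn c) hs))
  have hsum : Summable fun H : Multiset α => (H.map f).prod :=
    summable_of_sum_le hpos hupper
  have hle : ∑' H : Multiset α, (H.map f).prod ≤ Real.exp s :=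
    hsum.tsum_le_of_sum_le hupper
  have hge : Real.exp s ≤ ∑' H : Multiset α, (H.map f).prod := by
    refine le_of_tendsto ((Real.continuous_exp.tendsto s).comp hs) (Eventually.of_forall fun S => ?_)
    refine (hasSum_multiset_subtype_prod h0 h1 S).tsum_eq.symm.trans_le ?_
    exact hsum.tsum_subtype_le _ {H : Multiset α | ∀ c ∈ H, c ∈ S} hpos
  rw [← le_antisymm hle hge]
  exact hsum.hasSum

namespace CombClass

variable (C : CombClass.{u})

lemma finite_msize_eq (n : ℕ) : {G | C.msize G = n}.Finite := by
  refine Set.Finite.subset (Set.Finite.biUnion (Finset.finite_toSet (Finset.range (n + 1)))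
    fun N _ => C.finite_msets n N) fun G hG => ?_
  have hle : Multiset.card G ≤ C.msize G := by
    have h := Multiset.card_nsmul_le_sum (s := G.map C.size) (a := 1) (fun x hx => by
      obtain ⟨c, -, rfl⟩ := Multiset.mem_map.1 hx
      exact C.size_pos c)
    simpa [msize] using h
  have hG' : C.msize G = n := hG
  simp only [Set.mem_iUnion, msets, Set.mem_ofPred_eq]
  exact ⟨Multiset.card G, by simpa using by omega, hG', rfl⟩

variable {C}

lemma count_zero : C.count 0 = 0 := by
  rw [count, Set.ncard_eq_zero (C.finite_size_eq 0)]
  exact Set.eq_empty_of_forall_notMem fun c hc => (C.size_pos c).ne' hc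

lemma prod_map_pow_size (x : ℝ) (G : C.Mset) : (G.map fun c => x ^ C.size c).prod = x ^ C.msize G := by
  induction G using Multiset.induction_on with
  | empty => simp [msize]
  | cons a G ih => rw [Multiset.map_cons, Multiset.prod_cons, ih]; simp [msize, pow_add]

/-- The generating series of the multisets over `C`. -/
theorem hasSum_pow_msize {x : ℝ} (hx0 : 0 ≤ x) (hx1 : x < 1)
    (hs : Summable fun k => (C.count k : ℝ) * x ^ k) :
    HasSum (fun G : C.Mset => x ^ C.msize G) (C.msetSeries x) := by
  have hlt : ∀ c, x ^ C.size c < 1 := fun c => pow_lt_one₀ hx0 hx1 (C.size_pos c).ne'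
  have hs' : Summable fun c => x ^ C.size c :=
    (summable_pow_iff_summable_ncard C.size C.finite_size_eq hx0).2 hs
  have hlog : ∀ c, HasSum (fun j : ℕ => (x ^ C.size c) ^ (j + 1) / (j + 1))
      (-Real.log (1 - x ^ C.size c)) := fun c =>
    Real.hasSum_pow_div_log_of_abs_lt_one (by rw [abs_of_nonneg (by positivity)]; exact hlt c)
  -- The bound `-log (1 - y) ≤ y / (1 - y)` with `y ≤ x` makes the logarithms summable; their power
  -- series then give a nonnegative double series, whose order of summation may be exchanged.
  have hle : ∀ c, -Real.log (1 - x ^ C.size c) ≤ x ^ C.size c * (1 - x)⁻¹ := fun c => by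
    have hpos : 0 < 1 - x ^ C.size c := sub_pos.2 (hlt c)
    have h1 : x ^ C.size c ≤ x := pow_le_of_le_one hx0 hx1.le (C.size_pos c).ne'
    have h2 := Real.log_le_sub_one_of_pos (inv_pos.2 hpos)
    rw [Real.log_inv] at h2
    refine h2.trans ?_
    have h3 : (1 - x ^ C.size c)⁻¹ - 1 = x ^ C.size c * (1 - x ^ C.size c)⁻¹ := by
      field_simp; ring
    rw [h3]
    have : 0 < 1 - x := sub_pos.2 hx1
    gcongr
  have hnn : ∀ c, 0 ≤ -Real.log (1 - x ^ C.size c) := fun c => (hlog c).nonneg fun j => by positivity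
  have hsl : Summable fun c => -Real.log (1 - x ^ C.size c) :=
    Summable.of_nonneg_of_le hnn hle (hs'.mul_right _)
  have hdouble : Summable fun p : C.Obj × ℕ => (x ^ C.size p.1) ^ (p.2 + 1) / ((p.2 : ℝ) + 1) := by
    refine (summable_prod_of_nonneg fun p => by positivity).2 ⟨fun c => (hlog c).summable, ?_⟩
    exact hsl.congr fun c => (hlog c).tsum_eq.symm
  have hval : ∑' c, -Real.log (1 - x ^ C.size c) =
      ∑' j : ℕ, C.genSeries (x ^ (j + 1)) / (j + 1) := by
    rw [tsum_congr fun c => (hlog c).tsum_eq.symm]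
    rw [← Summable.tsum_comm (f := fun (c : C.Obj) (j : ℕ) =>
      (x ^ C.size c) ^ (j + 1) / ((j : ℝ) + 1)) hdouble]
    refine tsum_congr fun j => ?_
    rw [tsum_div_const, genSeries, show (∑' k, (C.count k : ℝ) * (x ^ (j + 1)) ^ k) = _ from
      (tsum_pow_eq_tsum_ncard C.size C.finite_size_eq (by positivity)).symm]
    congr 1
    exact tsum_congr fun c => by rw [← pow_mul, ← pow_mul, mul_comm]
  have h := hasSum_multiset_prod (fun c => by positivity) hlt hsl.hasSum
  rw [hval] at h
  simp only [prod_map_pow_size] at h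
  exact h

end CombClass

/-! ### Growth of sequences with a ratio limit. -/

section Sequences

variable {d : ℕ → ℝ} {ρ : ℝ}

lemma eventually_pos_of_tendsto_ratio (hd : ∀ n, 0 ≤ d n) (hρ : 0 < ρ)
    (h : Tendsto (fun n => d n / d (n + 1)) atTop (𝓝 ρ)) : ∀ᶠ n in atTop, 0 < d n := by
  filter_upwards [h.eventually (lt_mem_nhds hρ)] with n hn
  refine (hd n).lt_of_ne fun h0 => ?_
  rw [← h0, zero_div] at hn
  exact hn.false

lemma tendsto_ratio_add (hd : ∀ n, 0 ≤ d n) (hρ : 0 < ρ)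
    (h : Tendsto (fun n => d n / d (n + 1)) atTop (𝓝 ρ)) (j : ℕ) :
    Tendsto (fun n => d n / d (n + j)) atTop (𝓝 (ρ ^ j)) := by
  have hpos := eventually_pos_of_tendsto_ratio hd hρ h
  induction j with
  | zero =>
    rw [pow_zero]
    refine tendsto_const_nhds.congr' ?_
    filter_upwards [hpos] with n hn
    rw [add_zero, div_self hn.ne']
  | succ j ih =>
    rw [pow_succ]
    refine (ih.mul (h.comp (tendsto_add_atTop_nat j))).congr' ?_
    filter_upwards [(tendsto_add_atTop_nat j).eventually hpos] with n hn
    simp only [Function.comp_apply]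
    rw [div_mul_div_cancel₀ hn.ne', add_assoc]

lemma tendsto_ratio_sub (hd : ∀ n, 0 ≤ d n) (hρ : 0 < ρ)
    (h : Tendsto (fun n => d n / d (n + 1)) atTop (𝓝 ρ)) (j : ℕ) :
    Tendsto (fun n => d (n - j) / d n) atTop (𝓝 (ρ ^ j)) := by
  refine ((tendsto_ratio_add hd hρ h j).comp (tendsto_sub_atTop_nat j)).congr' ?_
  filter_upwards [eventually_ge_atTop j] with n hn
  simp [Nat.sub_add_cancel hn]

/-- By the ratio test `(n + 1) ^ s / d n` is summable, its ratio tending to `ρ < 1`; hence it tends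
to zero. -/
lemma eventually_pow_le_mul (hd : ∀ n, 0 ≤ d n) (hρ : 0 < ρ) (hρ1 : ρ < 1)
    (h : Tendsto (fun n => d n / d (n + 1)) atTop (𝓝 ρ)) (s : ℕ) {ε : ℝ} (hε : 0 < ε) :
    ∀ᶠ n : ℕ in atTop, ((n : ℝ) + 1) ^ s ≤ ε * d n := by
  have hpos := eventually_pos_of_tendsto_ratio hd hρ h
  have hr : Tendsto (fun n : ℕ => (((n : ℝ) + 1 + 1) / ((n : ℝ) + 1)) ^ s * (d n / d (n + 1))) atTop
      (𝓝 ρ) := by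
    have h1 : Tendsto (fun n : ℕ => 1 + 1 / ((n : ℝ) + 1)) atTop (𝓝 (1 + 0)) :=
      tendsto_one_div_add_atTop_nhds_zero_nat.const_add 1
    have h2 : Tendsto (fun n : ℕ => ((n : ℝ) + 1 + 1) / ((n : ℝ) + 1)) atTop (𝓝 1) := by
      rw [add_zero] at h1
      refine h1.congr fun n => ?_
      have : (n : ℝ) + 1 ≠ 0 := by positivity
      field_simp
    simpa using (h2.pow s).mul h
  have hsum : Summable fun n : ℕ => ((n : ℝ) + 1) ^ s / d n := by
    refine summable_of_ratio_test_tendsto_lt_one hρ1 ?_ (hr.congr' ?_)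
    · filter_upwards [hpos] with n hn
      positivity
    · filter_upwards [hpos, (tendsto_add_atTop_nat 1).eventually hpos] with n hn hn1
      rw [Real.norm_of_nonneg (by positivity), Real.norm_of_nonneg (by positivity), div_pow]
      push_cast
      field_simp
  filter_upwards [hsum.tendsto_atTop_zero.eventually (gt_mem_nhds hε), hpos] with n hn hn0
  exact ((div_lt_iff₀ hn0).1 hn).le

/-- If the middle part of the convolution of `g` and `d` carries the growth of `g` up to an error of
smaller order than `d`, then the growth of `g` is at most that of `d` times the sum of `g i * ρ ^ i`. -/
theorem eventually_le_mul_of_le_convolution (hd : ∀ n, 0 ≤ d n) (hρ : 0 < ρ)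
    (h : Tendsto (fun n => d n / d (n + 1)) atTop (𝓝 ρ))
    (hmid : ∀ ε > 0, ∃ K₀, ∀ K ≥ K₀, ∀ᶠ n in atTop,
      ∑ i ∈ Finset.Ioo K (n - K), d i * d (n - i) ≤ ε * d n)
    {g : ℕ → ℝ} (hg : ∀ n, 0 ≤ g n) {S : ℝ} (hS : HasSum (fun n => g n * ρ ^ n) S)
    {e : ℕ → ℕ → ℝ} (he : ∀ K, ∀ ε > 0, ∀ᶠ n in atTop, e K n ≤ ε * d n)
    (hle : ∀ K n, 2 * K < n → g n ≤ ∑ i ∈ Finset.range (K + 1), g i * d (n - i) +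
      ∑ i ∈ Finset.Ioo K (n - K), g i * d (n - i) + e K n)
    {ε : ℝ} (hε : 0 < ε) : ∀ᶠ n in atTop, g n ≤ (S + ε) * d n := by
  have hpos := eventually_pos_of_tendsto_ratio hd hρ h
  have hS0 : 0 ≤ S := hS.nonneg fun n => mul_nonneg (hg n) (by positivity)
  -- The ends of the convolution.
  have hends : ∀ K, ∀ η > 0, ∀ᶠ n in atTop,
      ∑ i ∈ Finset.range (K + 1), g i * d (n - i) + e K n ≤ (S + η) * d n := fun K η hη => by
    have ht : Tendsto (fun n => ∑ i ∈ Finset.range (K + 1), g i * (d (n - i) / d n)) atTop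
        (𝓝 (∑ i ∈ Finset.range (K + 1), g i * ρ ^ i)) :=
      tendsto_finsetSum _ fun i _ => (tendsto_ratio_sub hd hρ h i).const_mul _
    have hlt : ∑ i ∈ Finset.range (K + 1), g i * ρ ^ i < S + η / 2 :=
      (sum_le_hasSum _ (fun i _ => mul_nonneg (hg i) (by positivity)) hS).trans_lt (by linarith)
    filter_upwards [ht.eventually (gt_mem_nhds hlt), he K (η / 2) (half_pos hη), hpos]
      with n h1 h2 h3
    simp only [mul_div_assoc', ← Finset.sum_div] at h1
    rw [div_lt_iff₀ h3] at h1
    linarith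
  -- A crude bound.
  obtain ⟨M, L, hM, hgM⟩ : ∃ M L, 0 ≤ M ∧ ∀ n > L, g n ≤ M * d n := by
    obtain ⟨K₀, hK₀⟩ := hmid (1 / 2) (by norm_num)
    obtain ⟨K₁, hK₁⟩ := eventually_atTop.1 hpos
    obtain ⟨n₀, hn₀⟩ := eventually_atTop.1 ((hK₀ (max K₀ K₁) (le_max_left _ _)).and
      ((hends (max K₀ K₁) 1 one_pos).and (eventually_gt_atTop (2 * max K₀ K₁))))
    set K := max K₀ K₁
    have hdK : ∀ n > K, 0 < d n := fun n hn => hK₁ n ((le_max_right _ _).trans hn.le)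
    -- The finite sum covers the indices below `n₀`. Above, strong induction closes because `(S + 1)
    -- + M / 2 ≤ M`, the `1 / 2` being the bound on the middle part. Taking `K ≥ K₁` keeps the
    -- denominators positive.
    refine ⟨2 * (S + 1) + ∑ i ∈ Finset.range n₀, g i / d i, K, add_nonneg (by linarith)
      (Finset.sum_nonneg fun i _ => div_nonneg (hg i) (hd i)), fun n hn => ?_⟩
    set M := 2 * (S + 1) + ∑ i ∈ Finset.range n₀, g i / d i with hMdef
    have hsum0 : 0 ≤ ∑ i ∈ Finset.range n₀, g i / d i :=
      Finset.sum_nonneg fun i _ => div_nonneg (hg i) (hd i)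
    induction n using Nat.strong_induction_on with
    | _ n ih =>
      rcases lt_or_ge n n₀ with hlt | hge
      · have h1 : g n / d n ≤ M := by
          have := Finset.single_le_sum (f := fun i => g i / d i)
            (fun i _ => div_nonneg (hg i) (hd i)) (Finset.mem_range.2 hlt)
          linarith
        exact (div_le_iff₀ (hdK n hn)).1 h1
      · obtain ⟨h1, h2, h3⟩ := hn₀ n hge
        have h4 : ∑ i ∈ Finset.Ioo K (n - K), g i * d (n - i) ≤
            M * ∑ i ∈ Finset.Ioo K (n - K), d i * d (n - i) := by
          rw [Finset.mul_sum]
          refine Finset.sum_le_sum fun i hi => ?_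
          rw [Finset.mem_Ioo] at hi
          rw [← mul_assoc]
          exact mul_le_mul_of_nonneg_right (ih i (by omega) hi.1) (hd _)
        have h5 := hle K n h3
        have h6 := mul_le_mul_of_nonneg_left h1 (show 0 ≤ M by linarith)
        have h7 : 0 ≤ (∑ i ∈ Finset.range n₀, g i / d i) * d n := mul_nonneg hsum0 (hd n)
        have h8 : M * d n = 2 * (S + 1) * d n + (∑ i ∈ Finset.range n₀, g i / d i) * d n := by
          rw [hMdef]; ring
        linarith
  -- The crude bound costs a factor `M` in the middle part, which is undone by dividing here; `M +
  -- 1` avoids a zero denominator.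
  obtain ⟨K₀, hK₀⟩ := hmid (ε / 2 / (M + 1)) (by positivity)
  filter_upwards [hK₀ (max K₀ L) (le_max_left _ _), hends (max K₀ L) (ε / 2) (half_pos hε),
    eventually_gt_atTop (2 * max K₀ L)] with n h1 h2 h3
  have h4 : ∑ i ∈ Finset.Ioo (max K₀ L) (n - max K₀ L), g i * d (n - i) ≤
      M * ∑ i ∈ Finset.Ioo (max K₀ L) (n - max K₀ L), d i * d (n - i) := by
    rw [Finset.mul_sum]
    refine Finset.sum_le_sum fun i hi => ?_
    rw [Finset.mem_Ioo] at hi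
    rw [← mul_assoc]
    exact mul_le_mul_of_nonneg_right (hgM i ((le_max_right _ _).trans_lt hi.1)) (hd _)
  have h5 := hle _ n h3
  have h6 := mul_le_mul_of_nonneg_left h1 hM
  have h7 : M * (ε / 2 / (M + 1) * d n) ≤ ε / 2 * d n := by
    have h8 : M * (ε / 2 / (M + 1)) ≤ ε / 2 := by
      rw [mul_div_assoc', div_le_iff₀ (by positivity)]
      nlinarith
    rw [← mul_assoc]
    exact mul_le_mul_of_nonneg_right h8 (hd n)
  linarith

end Sequences

/-! ### The middle part of the convolution is negligible. -/

namespace IsSubexponential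

variable {c : ℕ → ℝ} {ρ : ℝ}

/-- The whole convolution is about `2 * s * c n`. Its two ends agree by reflection, and for large
`K` each is nearly `s * c n`, so little remains for the middle. -/
lemma convolution_middle (hc : IsSubexponential c ρ) {ε : ℝ} (hε : 0 < ε) :
    ∃ K₀, ∀ K ≥ K₀, ∀ᶠ n in atTop, ∑ i ∈ Finset.Ioo K (n - K), c i * c (n - i) ≤ ε * c n := by
  have hpos := eventually_pos_of_tendsto_ratio hc.nonneg hc.radius_pos hc.ratio
  set s := ∑' k, c k * ρ ^ k with hs
  have ht := (tendsto_add_atTop_nat 1).eventually (hc.summable.hasSum.tendsto_sum_nat.eventually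
    (lt_mem_nhds (show s - ε / 8 < s by linarith)))
  obtain ⟨K₀, hK₀⟩ := eventually_atTop.1 ht
  refine ⟨K₀, fun K hK => ?_⟩
  have hend : Tendsto (fun n => ∑ i ∈ Finset.range (K + 1), c i * (c (n - i) / c n)) atTop
      (𝓝 (∑ i ∈ Finset.range (K + 1), c i * ρ ^ i)) :=
    tendsto_finsetSum _ fun i _ => (tendsto_ratio_sub hc.nonneg hc.radius_pos hc.ratio i).const_mul _
  filter_upwards [hend.eventually (lt_mem_nhds (hK₀ K hK)), hpos, eventually_gt_atTop (2 * K),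
    hc.conv.eventually (gt_mem_nhds (show 2 * s < 2 * s + ε / 4 by linarith))] with n h1 h2 h3 h4
  simp only [mul_div_assoc', ← Finset.sum_div] at h1
  rw [lt_div_iff₀ h2] at h1
  rw [div_lt_iff₀ h2] at h4
  have hsplit : Finset.range (n + 1) = (Finset.range (K + 1) ∪ Finset.Ioo K (n - K)) ∪
      (Finset.range (K + 1)).image fun i => n - i := by
    ext i
    simp only [Finset.mem_union, Finset.mem_range, Finset.mem_Ioo, Finset.mem_image]
    constructor
    · intro hi
      by_cases h5 : i < K + 1
      · exact Or.inl (Or.inl h5)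
      · by_cases h6 : i < n - K
        · exact Or.inl (Or.inr ⟨by omega, h6⟩)
        · exact Or.inr ⟨n - i, by omega, by omega⟩
    · rintro ((h5 | h5) | ⟨j, h5, rfl⟩) <;> omega
  have hd1 : Disjoint (Finset.range (K + 1)) (Finset.Ioo K (n - K)) :=
    Finset.disjoint_left.2 fun i h5 h6 => by
      rw [Finset.mem_range] at h5; rw [Finset.mem_Ioo] at h6; omega
  have hd2 : Disjoint (Finset.range (K + 1) ∪ Finset.Ioo K (n - K))
      ((Finset.range (K + 1)).image fun i => n - i) :=
    Finset.disjoint_left.2 fun i h5 h6 => by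
      simp only [Finset.mem_union, Finset.mem_range, Finset.mem_Ioo, Finset.mem_image] at h5 h6
      obtain ⟨j, h7, rfl⟩ := h6
      omega
  have hinj : Set.InjOn (fun i => n - i) (Finset.range (K + 1) : Set ℕ) := fun i hi j hj hij => by
    simp only [Finset.coe_range, Set.mem_Iio] at hi hj hij
    omega
  rw [hsplit, Finset.sum_union hd2, Finset.sum_union hd1, Finset.sum_image hinj] at h4
  have hrefl : ∑ i ∈ Finset.range (K + 1), c (n - i) * c (n - (n - i)) =
      ∑ i ∈ Finset.range (K + 1), c i * c (n - i) :=
    Finset.sum_congr rfl fun i hi => by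
      rw [Finset.mem_range] at hi
      rw [Nat.sub_sub_self (by omega), mul_comm]
  rw [hrefl] at h4
  nlinarith

/-- The terms of the shifted convolution at `n` occur in that of `c` at `n + 2 * m`, and `c (n + 2 *
m)` is at most `2 / ρ ^ m` times `c (n + m)` eventually. Index `0` is left free since `C_{>m}` has
no object of reduced size `0` although `c m > 0`. -/
lemma convolution_middle_shift (hc : IsSubexponential c ρ) {d : ℕ → ℝ} {m : ℕ}
    (hd : ∀ n > 0, d n = c (n + m)) {ε : ℝ} (hε : 0 < ε) :
    ∃ K₀, ∀ K ≥ K₀, ∀ᶠ n in atTop, ∑ i ∈ Finset.Ioo K (n - K), d i * d (n - i) ≤ ε * d n := by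
  have hρ := hc.radius_pos
  have hpos := eventually_pos_of_tendsto_ratio hc.nonneg hc.radius_pos hc.ratio
  obtain ⟨K₀, hK₀⟩ := hc.convolution_middle (ε := ε * (ρ ^ m / 2)) (by positivity)
  have hr := (tendsto_add_atTop_nat m).eventually
    ((tendsto_ratio_add hc.nonneg hρ hc.ratio m).eventually
      (lt_mem_nhds (show ρ ^ m / 2 < ρ ^ m from half_lt_self (by positivity))))
  refine ⟨K₀, fun K hK => ?_⟩
  filter_upwards [(tendsto_add_atTop_nat (2 * m)).eventually (hK₀ (K + m) (by omega)), hr,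
    eventually_gt_atTop 0, (tendsto_add_atTop_nat (m + m)).eventually hpos] with n h1 h2 h3 h4
  rw [← add_assoc] at h4
  rw [lt_div_iff₀ h4] at h2
  have h5 : ∑ i ∈ Finset.Ioo K (n - K), d i * d (n - i) =
      ∑ i ∈ (Finset.Ioo K (n - K)).map (addRightEmbedding m), c i * c (n + 2 * m - i) := by
    rw [Finset.sum_map]
    refine Finset.sum_congr rfl fun i hi => ?_
    rw [Finset.mem_Ioo] at hi
    rw [hd i (by omega), hd (n - i) (by omega), addRightEmbedding_apply]
    congr 2
    omega
  rw [h5, hd n h3]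
  calc _ ≤ ∑ i ∈ Finset.Ioo (K + m) (n + 2 * m - (K + m)), c i * c (n + 2 * m - i) := by
        refine Finset.sum_le_sum_of_subset_of_nonneg (fun i hi => ?_)
          fun i _ _ => mul_nonneg (hc.nonneg _) (hc.nonneg _)
        simp only [Finset.mem_map, Finset.mem_Ioo, addRightEmbedding_apply] at hi ⊢
        omega
    _ ≤ ε * (ρ ^ m / 2) * c (n + 2 * m) := h1
    _ ≤ ε * c (n + m) := by
        rw [mul_assoc, two_mul, ← add_assoc]
        exact mul_le_mul_of_nonneg_left h2.le hε.le

end IsSubexponential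

/-! ### Counting multisets by size. -/

namespace CombClass

variable {C : CombClass.{u}}

@[simp] lemma msize_zero : C.msize 0 = 0 := rfl

@[simp] lemma msize_cons (c : C.Obj) (G : C.Mset) : C.msize (c ::ₘ G) = C.size c + C.msize G := by
  simp [msize]

@[simp] lemma msize_add (G H : C.Mset) : C.msize (G + H) = C.msize G + C.msize H := by
  simp [msize]

lemma size_le_msize {c : C.Obj} {G : C.Mset} (h : c ∈ G) : C.size c ≤ C.msize G :=
  Multiset.single_le_sum (fun _ _ => Nat.zero_le _) _ (Multiset.mem_map_of_mem C.size h)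

lemma card_le_msize (G : C.Mset) : Multiset.card G ≤ C.msize G := by
  induction G using Multiset.induction_on with
  | empty => simp
  | cons a G ih =>
    have := C.size_pos a
    rw [Multiset.card_cons, msize_cons]
    omega

lemma finite_size_le (K : ℕ) : {c | C.size c ≤ K}.Finite := by
  have : {c | C.size c ≤ K} = ⋃ k ∈ Finset.range (K + 1), {c | C.size c = k} := by
    ext c; simp
  rw [this]
  exact Set.Finite.biUnion (Finset.finite_toSet _) fun k _ => C.finite_size_eq k

/-- The multisets all of whose components are small grow polynomially. -/
lemma ncard_msize_eq_size_le (C : CombClass.{u}) (K n : ℕ) :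
    {G | C.msize G = n ∧ ∀ c ∈ G, C.size c ≤ K}.ncard ≤ (n + 1) ^ {c | C.size c ≤ K}.ncard := by
  classical
  have := (finite_size_le (C := C) K).to_subtype
  have := Fintype.ofFinite {c | C.size c ≤ K}
  -- A multiset is determined by its multiplicities, each at most `n` because sizes are positive, so
  -- `Fin.ofNat` does not wrap around.
  let f : C.Mset → ({c | C.size c ≤ K} → Fin (n + 1)) := fun G c => Fin.ofNat (n + 1) (G.count c.1)
  have hcard : (Set.univ : Set ({c | C.size c ≤ K} → Fin (n + 1))).ncard =
      (n + 1) ^ {c | C.size c ≤ K}.ncard := by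
    rw [Set.ncard_univ, Nat.card_fun, Nat.card_fin, Nat.card_coe_set_eq]
  rw [← hcard]
  refine Set.ncard_le_ncard_of_injOn f (fun _ _ => Set.mem_univ _) ?_ Set.finite_univ
  rintro G ⟨hG, hGK⟩ H ⟨hH, hHK⟩ hGH
  have hcount : ∀ A : C.Mset, C.msize A = n → ∀ c, A.count c < n + 1 := fun A hA c =>
    Nat.lt_succ_of_le ((Multiset.count_le_card c A).trans ((card_le_msize A).trans hA.le))
  ext c
  by_cases hc : C.size c ≤ K
  · have h := congrArg Fin.val (congrFun hGH ⟨c, hc⟩)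
    simpa [f, Fin.ofNat, Nat.mod_eq_of_lt (hcount G hG c), Nat.mod_eq_of_lt (hcount H hH c)] using h
  · rw [Multiset.count_eq_zero_of_notMem fun h => hc (hGK c h),
      Multiset.count_eq_zero_of_notMem fun h => hc (hHK c h)]

/-- Removing a component of size larger than `K` bounds the number of multisets by a convolution. -/
lemma ncard_msize_eq_le (C : CombClass.{u}) (K n : ℕ) :
    {G | C.msize G = n}.ncard ≤
      ∑ i ∈ Finset.range (K + 1), {G | C.msize G = i}.ncard * C.count (n - i) +
      ∑ i ∈ Finset.Ioo K (n - K), {G | C.msize G = i}.ncard * C.count (n - i) +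
      (n + 1) ^ {c | C.size c ≤ K}.ncard := by
  classical
  -- `A i` collects the multisets obtained by adjoining an object of size `n - i` to a multiset of
  -- size `i`. The removed object exceeds `K`, so `i < n - K` and the upper end of the convolution
  -- never occurs.
  let A : ℕ → Set C.Mset := fun i =>
    (fun p : C.Mset × C.Obj => p.2 ::ₘ p.1) '' ({G | C.msize G = i} ×ˢ {c | C.size c = n - i})
  have hA : ∀ i, (A i).ncard ≤ {G | C.msize G = i}.ncard * C.count (n - i) := fun i => by
    refine (Set.ncard_image_le ((C.finite_msize_eq i).prod (C.finite_size_eq (n - i)))).trans ?_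
    rw [Set.ncard_prod, count]
  have hAfin : ∀ i, (A i).Finite := fun i =>
    ((C.finite_msize_eq i).prod (C.finite_size_eq (n - i))).image _
  have hsub : {G | C.msize G = n} ⊆
      (⋃ i ∈ Finset.range (K + 1) ∪ Finset.Ioo K (n - K), A i) ∪
        {G | C.msize G = n ∧ ∀ c ∈ G, C.size c ≤ K} := by
    intro G hG
    have hG' : C.msize G = n := hG
    by_cases h : ∀ c ∈ G, C.size c ≤ K
    · exact Or.inr ⟨hG, h⟩
    · push Not at h
      obtain ⟨c, hc, hcK⟩ := h
      have hcons := Multiset.cons_erase hc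
      have hsize : C.size c + C.msize (G.erase c) = n := by
        rw [← hG', ← msize_cons, hcons]
      refine Or.inl ?_
      simp only [Set.mem_iUnion]
      refine ⟨C.msize (G.erase c), ?_, (G.erase c, c), ⟨rfl, ?_⟩, hcons⟩
      · simp only [Finset.mem_union, Finset.mem_range, Finset.mem_Ioo]
        omega
      · change C.size c = _
        omega
  have hfin : ((⋃ i ∈ Finset.range (K + 1) ∪ Finset.Ioo K (n - K), A i) ∪
        {G | C.msize G = n ∧ ∀ c ∈ G, C.size c ≤ K}).Finite :=
    (Set.Finite.biUnion (Finset.finite_toSet _) fun i _ => hAfin i).union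
      ((C.finite_msize_eq n).subset fun G hG => hG.1)
  have hdisj : Disjoint (Finset.range (K + 1)) (Finset.Ioo K (n - K)) :=
    Finset.disjoint_left.2 fun i h5 h6 => by
      rw [Finset.mem_range] at h5; rw [Finset.mem_Ioo] at h6; omega
  refine (Set.ncard_le_ncard hsub hfin).trans ((Set.ncard_union_le _ _).trans ?_)
  refine add_le_add ?_ (C.ncard_msize_eq_size_le K n)
  refine (Finset.set_ncard_biUnion_le _ _).trans ?_
  rw [Finset.sum_union hdisj]
  exact add_le_add (Finset.sum_le_sum fun i _ => hA i) (Finset.sum_le_sum fun i _ => hA i)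

/-! ### Separating the components of size `m` from the larger ones. -/

open Classical in
/-- The components of size larger than `m`, as a multiset over `C_{>m}`. -/
def aboveParts (C : CombClass.{u}) (m : ℕ) (G : C.Mset) : (C.above m).Mset :=
  G.filterMap fun c => if h : m < C.size c then some (C.toAbove m c h) else none

/-- The multisets of `K` objects, all of size `m`. -/
def constMsets (C : CombClass.{u}) (m K : ℕ) : Set C.Mset :=
  {B | Multiset.card B = K ∧ ∀ c ∈ B, C.size c = m}

variable {m : ℕ}

@[simp] lemma aboveParts_add (G H : C.Mset) :
    C.aboveParts m (G + H) = C.aboveParts m G + C.aboveParts m H :=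
  Multiset.filterMap_add _ _ _

lemma aboveParts_cons_ofAbove (c : (C.above m).Obj) (G : C.Mset) :
    C.aboveParts m (C.ofAbove m c ::ₘ G) = c ::ₘ C.aboveParts m G :=
  Multiset.filterMap_cons_some _ _ _ (by
    have hc : m < C.size (C.ofAbove m c) := c.2
    simp only [hc, dite_true]
    rfl)

lemma aboveParts_map_ofAbove (H : (C.above m).Mset) :
    C.aboveParts m (H.map (C.ofAbove m)) = H := by
  induction H using Multiset.induction_on with
  | empty => rfl
  | cons a H ih => rw [Multiset.map_cons, aboveParts_cons_ofAbove, ih]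

lemma aboveParts_eq_zero {G : C.Mset} (h : ∀ c ∈ G, C.size c ≤ m) : C.aboveParts m G = 0 := by
  induction G using Multiset.induction_on with
  | empty => rfl
  | cons a G ih =>
    rw [aboveParts, Multiset.filterMap_cons_none _ _ (by
      have := h a (Multiset.mem_cons_self a G)
      simp [this])]
    exact ih fun c hc => h c (Multiset.mem_cons_of_mem hc)

lemma map_ofAbove_aboveParts (G : C.Mset) :
    (C.aboveParts m G).map (C.ofAbove m) = G.filter fun c => m < C.size c := by
  induction G using Multiset.induction_on with
  | empty => rfl
  | cons a G ih =>
    rw [← Multiset.singleton_add, aboveParts_add, Multiset.map_add, ih, Multiset.filter_add]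
    congr 1
    by_cases ha : m < C.size a
    · rw [Multiset.filter_singleton, if_pos ha]
      have : ({a} : C.Mset) = Multiset.map (C.ofAbove m) {C.toAbove m a ha} := by
        rw [Multiset.map_singleton]
        rfl
      rw [this, aboveParts_map_ofAbove]
    · rw [Multiset.filter_singleton, if_neg ha, aboveParts_eq_zero (by simpa using ha)]
      rfl

lemma msize_map_ofAbove (H : (C.above m).Mset) :
    C.msize (H.map (C.ofAbove m)) = (C.above m).msize H + m * Multiset.card H := by
  induction H using Multiset.induction_on with
  | empty => simp
  | cons a H ih =>
    have ha : m < C.size (C.ofAbove m a) := a.2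
    have ha' : (C.above m).size a = C.size (C.ofAbove m a) - m := rfl
    rw [Multiset.map_cons, msize_cons, msize_cons, ih, Multiset.card_cons, ha', mul_add, mul_one]
    omega

lemma msize_of_mem_constMsets {K : ℕ} {B : C.Mset} (hB : B ∈ C.constMsets m K) :
    C.msize B = m * K := by
  rw [msize, Multiset.map_congr rfl hB.2, Multiset.map_const', Multiset.sum_replicate, hB.1,
    smul_eq_mul, mul_comm]

lemma constMsets_subset_msets (K : ℕ) : C.constMsets m K ⊆ C.msets (m * K) K :=
  fun _ hB => ⟨msize_of_mem_constMsets hB, hB.1⟩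

lemma finite_constMsets (K : ℕ) : (C.constMsets m K).Finite :=
  (C.finite_msets _ _).subset (constMsets_subset_msets K)

lemma ncard_constMsets (C : CombClass.{u}) (m K : ℕ) :
    (C.constMsets m K).ncard = (C.count m).multichoose K := by
  classical
  have := (C.finite_size_eq m).to_subtype
  have hr : C.constMsets m K =
      (fun s : Sym {c // C.size c = m} K => s.1.map Subtype.val) '' Set.univ := by
    ext B
    simp only [Set.image_univ, Set.mem_range]
    constructor
    · rintro ⟨hB, hBm⟩
      exact ⟨⟨B.attach.map fun c => ⟨c.1, hBm c.1 c.2⟩, by simp [hB]⟩, by simp [Multiset.map_map]⟩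
    · rintro ⟨s, rfl⟩
      refine ⟨by simp, fun c hc => ?_⟩
      obtain ⟨a, -, rfl⟩ := Multiset.mem_map.1 hc
      exact a.2
  have hinj : Function.Injective
      (fun s : Sym {c // C.size c = m} K => s.1.map Subtype.val) := fun s t hst =>
    Subtype.ext (Multiset.map_injective Subtype.val_injective hst)
  rw [hr, Set.ncard_image_of_injective _ hinj, Set.ncard_univ, Sym.natCard_sym_eq_multichoose]
  rfl

lemma filter_not_lt_mem_constMsets (hm : ∀ c, m ≤ C.size c) (G : C.Mset) :
    (G.filter fun c => ¬ m < C.size c) ∈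
      C.constMsets m (Multiset.card (G.filter fun c => ¬ m < C.size c)) :=
  ⟨rfl, fun c hc => by
    have := hm c
    have := (Multiset.mem_filter.1 hc).2
    omega⟩

lemma map_ofAbove_aboveParts_add_filter (G : C.Mset) :
    (C.aboveParts m G).map (C.ofAbove m) + (G.filter fun c => ¬ m < C.size c) = G := by
  rw [map_ofAbove_aboveParts, Multiset.filter_add_not]

lemma replicate_add_mem_constMsets {c₀ : C.Obj} (hc₀ : C.size c₀ = m) {K : ℕ} {B : C.Mset}
    (hB : B ∈ C.constMsets m K) (k : ℕ) :
    Multiset.replicate k c₀ + B ∈ C.constMsets m (k + K) :=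
  ⟨by rw [Multiset.card_add, Multiset.card_replicate, hB.1], fun c hc => by
    rcases Multiset.mem_add.1 hc with h | h
    · rw [Multiset.eq_of_mem_replicate h, hc₀]
    · exact hB.2 c h⟩

lemma card_aboveParts_add (G : C.Mset) : Multiset.card (C.aboveParts m G) +
    Multiset.card (G.filter fun c => ¬ m < C.size c) = Multiset.card G := by
  conv_rhs => rw [← map_ofAbove_aboveParts_add_filter (m := m) G]
  rw [Multiset.card_add, Multiset.card_map]

lemma msize_aboveParts (hm : ∀ c, m ≤ C.size c) (G : C.Mset) :
    (C.above m).msize (C.aboveParts m G) + m * Multiset.card G = C.msize G := by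
  conv_rhs => rw [← map_ofAbove_aboveParts_add_filter (m := m) G]
  rw [msize_add, msize_map_ofAbove, msize_of_mem_constMsets (filter_not_lt_mem_constMsets hm G),
    ← card_aboveParts_add (m := m) G]
  ring

/-- Replacing each component larger than `m` by a copy of `c₀` gives `N` objects of size `m`.
Together with the larger components this determines the multiset, as their number tells how many
copies to delete. -/
lemma ncard_msets_le (hm : ∀ c, m ≤ C.size c) {c₀ : C.Obj} (hc₀ : C.size c₀ = m) (r N : ℕ) :
    (C.msets (r + m * N) N).ncard ≤
      {H | (C.above m).msize H = r}.ncard * (C.count m).multichoose N := by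
  rw [← ncard_constMsets, ← Set.ncard_prod]
  refine Set.ncard_le_ncard_of_injOn (fun G => (C.aboveParts m G,
    Multiset.replicate (Multiset.card (C.aboveParts m G)) c₀ +
      G.filter fun c => ¬ m < C.size c)) ?_ ?_
    (((C.above m).finite_msize_eq r).prod (finite_constMsets N))
  · rintro G ⟨hG, hGN⟩
    refine ⟨?_, ?_⟩
    · have := msize_aboveParts hm G
      rw [hG, hGN] at this
      exact Nat.add_right_cancel this
    · have := replicate_add_mem_constMsets hc₀ (filter_not_lt_mem_constMsets hm G)
        (Multiset.card (C.aboveParts m G))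
      rwa [card_aboveParts_add, hGN] at this
  · intro G _ G' _ h
    obtain ⟨h1, h2⟩ := Prod.mk.inj h
    rw [h1] at h2
    rw [← map_ofAbove_aboveParts_add_filter (m := m) G, h1, add_left_cancel h2,
      map_ofAbove_aboveParts_add_filter]

/-- An object exceeding the total reduced size of `H` is the unique largest component, so any rule
`pick` must select it. -/
lemma remainder_eq {pick : C.Mset → C.Obj} (hpick : C.IsLargestChoice pick) {H : (C.above m).Mset}
    {c : (C.above m).Obj} (hc : (C.above m).msize H < (C.above m).size c) {K : ℕ} {B : C.Mset}
    (hB : B ∈ C.constMsets m K) :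
    C.remainder m pick (C.ofAbove m c ::ₘ (H.map (C.ofAbove m) + B)) = H := by
  classical
  have hsize : ∀ a : (C.above m).Obj, C.size (C.ofAbove m a) = (C.above m).size a + m := fun a =>
    (Nat.sub_add_cancel (le_of_lt a.2)).symm
  have hp : pick (C.ofAbove m c ::ₘ (H.map (C.ofAbove m) + B)) = C.ofAbove m c := by
    obtain ⟨h1, h2⟩ := hpick _ (Multiset.cons_ne_zero (a := C.ofAbove m c)
      (m := H.map (C.ofAbove m) + B))
    have h3 := h2 _ (Multiset.mem_cons_self _ _)
    rw [hsize] at h3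
    rcases Multiset.mem_cons.1 h1 with h | h
    · exact h
    rcases Multiset.mem_add.1 h with h | h
    · obtain ⟨a, ha, hap⟩ := Multiset.mem_map.1 h
      have := size_le_msize ha
      rw [← hap, hsize] at h3
      omega
    · rw [hB.2 _ h] at h3
      omega
  have hr : C.remainder m pick (C.ofAbove m c ::ₘ (H.map (C.ofAbove m) + B)) =
      C.aboveParts m (H.map (C.ofAbove m) + B) := by
    have : (C.ofAbove m c ::ₘ (H.map (C.ofAbove m) + B)).erase
        (pick (C.ofAbove m c ::ₘ (H.map (C.ofAbove m) + B))) = H.map (C.ofAbove m) + B := by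
      rw [hp, Multiset.erase_cons_head]
    conv_rhs => rw [← this]
    unfold remainder aboveParts
    congr!
  rw [hr, aboveParts_add, aboveParts_map_ofAbove, aboveParts_eq_zero fun b hb => (hB.2 b hb).le,
    add_zero]

/-- The condition `2 * |H| < r` makes the adjoined object of size `r - |H|` larger than all of `H`
together, so `remainder_eq` applies. -/
lemma le_ncard_remainder_eq {pick : C.Mset → C.Obj} (hpick : C.IsLargestChoice pick)
    (H : (C.above m).Mset) {r N : ℕ} (hr : 2 * (C.above m).msize H < r)
    (hN : Multiset.card H + 1 ≤ N) :
    (C.above m).count (r - (C.above m).msize H) *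
        (C.count m).multichoose (N - (Multiset.card H + 1)) ≤
      (C.msets (r + m * N) N ∩ C.remainder m pick ⁻¹' {H}).ncard := by
  rw [← ncard_constMsets, count, ← Set.ncard_prod]
  refine Set.ncard_le_ncard_of_injOn
    (fun p => C.ofAbove m p.1 ::ₘ (H.map (C.ofAbove m) + p.2)) ?_ ?_
    ((C.finite_msets _ _).subset Set.inter_subset_left)
  · rintro ⟨c, B⟩ ⟨hc, hB⟩
    have hc' : (C.above m).size c = r - (C.above m).msize H := hc
    have hsize : C.size (C.ofAbove m c) = (C.above m).size c + m :=
      (Nat.sub_add_cancel (le_of_lt c.2)).symm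
    have hlt : (C.above m).msize H < (C.above m).size c := by omega
    refine ⟨⟨?_, ?_⟩, remainder_eq hpick hlt hB⟩
    · rw [msize_cons, msize_add, msize_map_ofAbove, msize_of_mem_constMsets hB, hsize, hc']
      obtain ⟨k, rfl⟩ := Nat.exists_eq_add_of_le hN
      rw [Nat.add_sub_cancel_left, mul_add, mul_add]
      omega
    · rw [Multiset.card_cons, Multiset.card_add, Multiset.card_map, hB.1]
      omega
  · rintro ⟨c, B⟩ ⟨-, hB⟩ ⟨c', B'⟩ ⟨-, hB'⟩ h
    simp only at h
    have h1 := congrArg (C.aboveParts m) h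
    rw [aboveParts_cons_ofAbove, aboveParts_cons_ofAbove, aboveParts_add, aboveParts_add,
      aboveParts_eq_zero fun b hb => (hB.2 b hb).le,
      aboveParts_eq_zero fun b hb => (hB'.2 b hb).le] at h1
    obtain rfl := (Multiset.cons_inj_left _).1 h1
    rw [add_left_cancel ((Multiset.cons_inj_right _).1 h)]

lemma count_above (C : CombClass.{u}) (m : ℕ) {k : ℕ} (hk : 0 < k) :
    (C.above m).count k = C.count (k + m) := by
  have : {c | C.size c = k + m} = C.ofAbove m '' {c | (C.above m).size c = k} := by
    ext c
    constructor
    · intro hc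
      have hc' : C.size c = k + m := hc
      exact ⟨⟨c, by omega⟩, show C.size c - m = k by omega, rfl⟩
    · rintro ⟨a, ha, rfl⟩
      have h1 : m < C.size (C.ofAbove m a) := a.2
      have h2 : C.size (C.ofAbove m a) - m = k := ha
      change C.size (C.ofAbove m a) = k + m
      omega
  rw [count, count, this, Set.ncard_image_of_injective _
    (show Function.Injective (C.ofAbove m) from Subtype.val_injective)]

end CombClass

/-! ### Two limit tools. -/

lemma tendsto_multichoose_ratio {s : ℕ} (hs : 0 < s) :
    Tendsto (fun K => (s.multichoose K : ℝ) / (s.multichoose (K + 1) : ℝ)) atTop (𝓝 1) := by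
  have h := tendsto_natCast_div_add_atTop ((s : ℝ) - 1)
  refine (h.comp (tendsto_add_atTop_nat 1)).congr fun K => ?_
  have hmul : s.multichoose (K + 1) * (K + 1) = (s + K) * s.multichoose K := by
    obtain ⟨t, rfl⟩ := Nat.exists_eq_add_of_le' hs
    rw [Nat.multichoose_eq, Nat.multichoose_eq, show t + 1 + (K + 1) - 1 = (t + K) + 1 by omega,
      show t + 1 + K - 1 = t + K by omega, ← Nat.add_one_mul_choose_eq]
    ring
  have hmul' : (s.multichoose (K + 1) : ℝ) * ((K : ℝ) + 1) = (s + K) * s.multichoose K := by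
    exact_mod_cast hmul
  have h0 : 0 < s.multichoose (K + 1) := by
    rw [Nat.multichoose_eq]
    exact Nat.choose_pos (by omega)
  have h0' : (0 : ℝ) < s.multichoose (K + 1) := by exact_mod_cast h0
  have h1 : (0 : ℝ) < s + K := by positivity
  simp only [Function.comp_apply]
  push_cast
  rw [show (K : ℝ) + 1 + (s - 1) = s + K by ring, div_eq_div_iff h1.ne' h0'.ne']
  linarith

/-- A Fatou argument: the lower bounds on finitely many atoms give `P G ≤ liminf μ i G` for open
`G`, and the portmanteau theorem does the rest since all the measures have total mass one. -/
lemma PMF.tendsto_toMeasure_of_forall_lt {Ω : Type*} [TopologicalSpace Ω] [MeasurableSpace Ω]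
    [OpensMeasurableSpace Ω] [MeasurableSingletonClass Ω] {ι : Type*} {L : Filter ι} [L.NeBot]
    [L.IsCountablyGenerated] (p : PMF Ω) {P : ProbabilityMeasure Ω}
    (hP : (P : Measure Ω) = p.toMeasure) {μ : ι → ProbabilityMeasure Ω}
    (h : ∀ ω, ∀ b < p ω, ∀ᶠ i in L, b < (μ i : Measure Ω) {ω}) : Tendsto μ L (𝓝 P) := by
  classical
  refine tendsto_of_forall_isOpen_le_liminf' fun G hG => ?_
  rw [hP, p.toMeasure_apply hG.measurableSet, ENNReal.tsum_eq_iSup_sum]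
  refine iSup_le fun F => ?_
  -- Capping the atoms at `p ω` turns one-sided bounds into genuine limits, which can be summed.
  have hmin : ∀ ω, Tendsto (fun i => min ((μ i : Measure Ω) {ω}) (p ω)) L (𝓝 (p ω)) := fun ω =>
    tendsto_order.2 ⟨fun b hb => (h ω b hb).mono fun i hi => lt_min hi hb,
      fun b hb => Eventually.of_forall fun i => (min_le_right _ _).trans_lt hb⟩
  have hsum : Tendsto (fun i => ∑ ω ∈ F with ω ∈ G, min ((μ i : Measure Ω) {ω}) (p ω)) L
      (𝓝 (∑ ω ∈ F with ω ∈ G, p ω)) := tendsto_finsetSum _ fun ω _ => hmin ω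
  have hF : ∑ ω ∈ F, G.indicator p ω = ∑ ω ∈ F with ω ∈ G, p ω := by
    rw [Finset.sum_filter]
    rfl
  rw [hF, ← hsum.liminf_eq]
  refine liminf_le_liminf (Eventually.of_forall fun i => ?_)
  calc ∑ ω ∈ F with ω ∈ G, min ((μ i : Measure Ω) {ω}) (p ω)
      ≤ ∑ ω ∈ F with ω ∈ G, (μ i : Measure Ω) {ω} := Finset.sum_le_sum fun ω _ => min_le_left _ _
    _ = (μ i : Measure Ω) (({ω ∈ F | ω ∈ G} : Finset Ω) : Set Ω) :=
        sum_measure_singleton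
    _ ≤ (μ i : Measure Ω) G := measure_mono fun ω hω => (Finset.mem_filter.1 hω).2

/-! ### Asymptotics of the law of the remainder. -/

namespace CombClass

variable {C : CombClass.{u}} {ρ : ℝ} {m : ℕ}

lemma uniformMeasure_real_apply {n N : ℕ} (h : (C.msets n N).Nonempty) (t : Set C.Mset) :
    (C.uniformMeasure n N).real t = ((C.msets n N ∩ t).ncard : ℝ) / (C.msets n N).ncard := by
  have hf := C.finite_msets n N
  rw [uniformMeasure, if_pos h, Measure.real, uniformOn, cond_apply MeasurableSet.of_discrete,
    Measure.count_apply MeasurableSet.of_discrete, Measure.count_apply MeasurableSet.of_discrete,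
    ← hf.cast_ncard_eq, ← (hf.subset Set.inter_subset_left).cast_ncard_eq, ENNReal.toReal_mul,
    ENNReal.toReal_inv]
  simp [div_eq_inv_mul]

lemma le_size_of_isLeast (hm : IsLeast {k | 0 < C.count k} m) (c : C.Obj) : m ≤ C.size c :=
  hm.2 ((Set.ncard_pos (C.finite_size_eq _)).2 ⟨c, rfl⟩)

lemma hasSum_count_above (hm : IsLeast {k | 0 < C.count k} m) {x : ℝ} (hx : 0 < x)
    (hs : Summable fun k => (C.count k : ℝ) * x ^ k) :
    HasSum (fun k => ((C.above m).count k : ℝ) * x ^ k)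
      ((C.genSeries x - C.count m * x ^ m) / x ^ m) := by
  have h1 := (hasSum_nat_add_iff' (m + 1)).2 hs.hasSum
  have h2 : ∑ i ∈ Finset.range (m + 1), (C.count i : ℝ) * x ^ i = C.count m * x ^ m := by
    rw [Finset.sum_range_succ, Finset.sum_eq_zero, zero_add]
    intro i hi
    have : C.count i = 0 := by
      by_contra h0
      exact absurd (hm.2 (Nat.pos_of_ne_zero h0)) (not_le.2 (Finset.mem_range.1 hi))
    rw [this, Nat.cast_zero, zero_mul]
  rw [h2] at h1
  refine (hasSum_nat_add_iff' 1).1 ?_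
  rw [Finset.sum_range_one, count_zero, Nat.cast_zero, zero_mul, sub_zero]
  refine (h1.div_const (x ^ m)).congr_fun fun k => ?_
  rw [count_above C m k.succ_pos, show k + (m + 1) = k + 1 + m by ring, pow_add x (k + 1) m]
  field_simp

lemma hasSum_ncard_msize (hx0 : 0 ≤ ρ) (hx1 : ρ < 1)
    (hs : Summable fun k => (C.count k : ℝ) * ρ ^ k) :
    HasSum (fun n => ({G | C.msize G = n}.ncard : ℝ) * ρ ^ n) (C.msetSeries ρ) := by
  have h := hasSum_pow_msize hx0 hx1 hs
  rw [((summable_pow_iff_summable_ncard C.msize C.finite_msize_eq hx0).1 h.summable).hasSum_iff,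
    ← tsum_pow_eq_tsum_ncard C.msize C.finite_msize_eq hx0, h.tsum_eq]

/-- The counts are integers and eventually at least one, while `c_n * ρ ^ n` tends to zero. -/
lemma lt_one_of_isSubexponential (hC : IsSubexponential (fun k => (C.count k : ℝ)) ρ) : ρ < 1 := by
  have hpos := eventually_pos_of_tendsto_ratio hC.nonneg hC.radius_pos hC.ratio
  by_contra! h
  obtain ⟨n, h1, h2⟩ := (hpos.and (hC.summable.tendsto_atTop_zero.eventually
    (gt_mem_nhds one_pos))).exists
  have h3 : (1 : ℝ) ≤ C.count n := by
    have : 0 < C.count n := by exact_mod_cast h1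
    exact_mod_cast this
  have h4 : 1 ≤ ρ ^ n := one_le_pow₀ h
  nlinarith

lemma tendsto_ratio_count_above (hC : IsSubexponential (fun k => (C.count k : ℝ)) ρ) :
    Tendsto (fun n => ((C.above m).count n : ℝ) / (C.above m).count (n + 1)) atTop (𝓝 ρ) := by
  refine (hC.ratio.comp (tendsto_add_atTop_nat m)).congr' ?_
  filter_upwards [eventually_gt_atTop 0] with n hn
  rw [count_above C m hn, count_above C m n.succ_pos, Function.comp_apply,
    show n + 1 + m = n + m + 1 by ring]

/-- The multisets over `C_{>m}` grow at most like its objects times the Boltzmann normalisation. -/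
lemma eventually_ncard_msize_above_le (hC : IsSubexponential (fun k => (C.count k : ℝ)) ρ)
    (hm : IsLeast {k | 0 < C.count k} m) {ε : ℝ} (hε : 0 < ε) :
    ∀ᶠ n in atTop, ({H | (C.above m).msize H = n}.ncard : ℝ) ≤
      ((C.above m).msetSeries ρ + ε) * (C.above m).count n := by
  have hρ := hC.radius_pos
  have hρ1 := lt_one_of_isSubexponential hC
  have hr := tendsto_ratio_count_above (m := m) hC
  have hnn : ∀ n, (0 : ℝ) ≤ (C.above m).count n := fun n => Nat.cast_nonneg _
  refine eventually_le_mul_of_le_convolution hnn hρ hr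
    (fun η hη => hC.convolution_middle_shift (m := m)
      (fun n hn => by rw [count_above C m hn]) hη)
    (fun n => Nat.cast_nonneg _)
    (hasSum_ncard_msize hρ.le hρ1 (hasSum_count_above hm hρ hC.summable).summable)
    (e := fun K n => ((n : ℝ) + 1) ^ {c | (C.above m).size c ≤ K}.ncard)
    (fun K η hη => eventually_pow_le_mul hnn hρ hρ1 hr _ hη) (fun K n _ => ?_) hε
  exact_mod_cast (C.above m).ncard_msize_eq_le K n

lemma eventually_lt_remainderLaw (hC : IsSubexponential (fun k => (C.count k : ℝ)) ρ)
    (hm : IsLeast {k | 0 < C.count k} m) {pick : C.Mset → C.Obj} (hpick : C.IsLargestChoice pick)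
    (H : (C.above m).Mset) {a : ℝ}
    (ha : a < ρ ^ (C.above m).msize H / (C.above m).msetSeries ρ) :
    ∀ᶠ p : ℕ × ℕ in atTop ×ˢ atTop, (C.msets (p.1 + m * p.2) p.2).Nonempty ∧
      a < (C.remainderLaw m pick (p.1 + m * p.2) p.2 : Measure (C.above m).Mset).real {H} := by
  have hρ := hC.radius_pos
  have hr := tendsto_ratio_count_above (m := m) hC
  have hnn : ∀ n, (0 : ℝ) ≤ (C.above m).count n := fun n => Nat.cast_nonneg _
  have hpos := eventually_pos_of_tendsto_ratio hnn hρ hr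
  have hS : 0 < (C.above m).msetSeries ρ := Real.exp_pos _
  obtain ⟨c₀, hc₀⟩ := (Set.ncard_pos (C.finite_size_eq m)).1 hm.1
  have hb : ∀ K, (0 : ℝ) ≤ (C.count m).multichoose K := fun K => Nat.cast_nonneg _
  have hbr := tendsto_multichoose_ratio hm.1
  have hbpos := eventually_pos_of_tendsto_ratio hb one_pos hbr
  -- The strict inequality leaves room for the error `δ` in the upper bound on the number of
  -- multisets over `C_{>m}`.
  obtain ⟨δ, hδ, hδa⟩ : ∃ δ > 0,
      a < ρ ^ (C.above m).msize H / ((C.above m).msetSeries ρ + δ) := by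
    have hcont : Tendsto (fun δ => ρ ^ (C.above m).msize H / ((C.above m).msetSeries ρ + δ))
        (𝓝[>] 0) (𝓝 (ρ ^ (C.above m).msize H / ((C.above m).msetSeries ρ + 0))) := by
      refine Tendsto.mono_left (ContinuousAt.tendsto ?_) nhdsWithin_le_nhds
      exact continuousAt_const.div (continuousAt_const.add continuousAt_id) (by simpa using hS.ne')
    rw [add_zero] at hcont
    exact ((eventually_mem_nhdsWithin (a := (0 : ℝ)) (s := Set.Ioi 0)).and
      (hcont.eventually (lt_mem_nhds ha))).exists
  have h1 := (tendsto_ratio_sub hnn hρ hr ((C.above m).msize H)).comp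
    (tendsto_fst (f := (atTop : Filter ℕ)) (g := (atTop : Filter ℕ)))
  have h2 := (tendsto_ratio_sub hb one_pos hbr (Multiset.card H + 1)).comp
    (tendsto_snd (f := (atTop : Filter ℕ)) (g := (atTop : Filter ℕ)))
  have h3 := (h1.mul h2).div_const ((C.above m).msetSeries ρ + δ)
  rw [one_pow, mul_one] at h3
  have hfst : Tendsto Prod.fst ((atTop : Filter ℕ) ×ˢ (atTop : Filter ℕ)) atTop := tendsto_fst
  have hsnd : Tendsto Prod.snd ((atTop : Filter ℕ) ×ˢ (atTop : Filter ℕ)) atTop := tendsto_snd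
  filter_upwards [h3.eventually (lt_mem_nhds hδa),
    hfst.eventually (eventually_ncard_msize_above_le hC hm hδ),
    hfst.eventually (eventually_gt_atTop (2 * (C.above m).msize H)),
    hfst.eventually hpos, hsnd.eventually hbpos,
    hfst.eventually ((tendsto_sub_atTop_nat ((C.above m).msize H)).eventually hpos),
    hsnd.eventually ((tendsto_sub_atTop_nat (Multiset.card H + 1)).eventually hbpos),
    hsnd.eventually (eventually_ge_atTop (Multiset.card H + 1))]
    with ⟨r, N⟩ k1 k2 k3 k4 k5 k6 k7 k8
  simp only [Function.comp_apply] at k1 k2 k3 k4 k5 k6 k7 k8 ⊢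
  have hlow := le_ncard_remainder_eq hpick H k3 k8
  have hlow' : ((C.above m).count (r - (C.above m).msize H) : ℝ) *
      (C.count m).multichoose (N - (Multiset.card H + 1)) ≤
      (C.msets (r + m * N) N ∩ C.remainder m pick ⁻¹' {H}).ncard := by exact_mod_cast hlow
  have hup : ((C.msets (r + m * N) N).ncard : ℝ) ≤
      {H | (C.above m).msize H = r}.ncard * (C.count m).multichoose N := by
    exact_mod_cast ncard_msets_le (le_size_of_isLeast hm) hc₀ r N
  have hne : (C.msets (r + m * N) N ∩ C.remainder m pick ⁻¹' {H}).Nonempty := by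
    rw [← Set.ncard_pos ((C.finite_msets _ _).subset Set.inter_subset_left)]
    have := (mul_pos k6 k7).trans_le hlow'
    exact_mod_cast this
  have hne' : (C.msets (r + m * N) N).Nonempty := hne.mono Set.inter_subset_left
  refine ⟨hne', ?_⟩
  have hcard : (0 : ℝ) < (C.msets (r + m * N) N).ncard := by
    exact_mod_cast (Set.ncard_pos (C.finite_msets _ _)).2 hne'
  have hlaw : (C.remainderLaw m pick (r + m * N) N : Measure (C.above m).Mset).real {H} =
      (C.uniformMeasure (r + m * N) N).real (C.remainder m pick ⁻¹' {H}) := by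
    rw [remainderLaw, ProbabilityMeasure.toMeasure_map,
      map_measureReal_apply Measurable.of_discrete MeasurableSet.of_discrete]
    rfl
  rw [hlaw, uniformMeasure_real_apply hne']
  refine k1.trans_le ?_
  have hup' : ((C.msets (r + m * N) N).ncard : ℝ) ≤
      ((C.above m).msetSeries ρ + δ) * (C.above m).count r * (C.count m).multichoose N :=
    hup.trans (mul_le_mul_of_nonneg_right k2 k5.le)
  rw [div_mul_div_comm, div_div]
  refine div_le_div₀ (Nat.cast_nonneg _) hlow' hcard (hup'.trans_eq (by ring))

end CombClass

/-! ### The limit theorem. -/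

theorem theorem4 (C : CombClass.{u}) (ρ : ℝ)
    (hC : IsSubexponential (fun k => (C.count k : ℝ)) ρ)
    (m : ℕ) (hm : IsLeast {k | 0 < C.count k} m)
    (pick : C.Mset → C.Obj) (hpick : C.IsLargestChoice pick)
    {ι : Type*} (l : Filter ι) (n N : ι → ℕ)
    (hn : Tendsto n l atTop) (hN : Tendsto N l atTop)
    (hnN : Tendsto (fun i => (n i : ℤ) - (m : ℤ) * (N i : ℤ)) l atTop) :
    (∀ᶠ i in l, (C.msets (n i) (N i)).Nonempty) ∧
    ∃ P : ProbabilityMeasure (C.above m).Mset,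
      (C.above m).IsBoltzmann ρ P ∧
      (∀ G : (C.above m).Mset, (P : Measure (C.above m).Mset).real {G} =
        Real.exp (-∑' j : ℕ, (C.genSeries (ρ ^ (j + 1)) - C.count m * ρ ^ ((j + 1) * m)) /
            ((j + 1) * ρ ^ ((j + 1) * m))) *
          ρ ^ ((C.msize (G.map (C.ofAbove m)) : ℤ) - m * Multiset.card G)) ∧
      Tendsto (fun i => C.remainderLaw m pick (n i) (N i)) l (𝓝 P) := by
  have hρ := hC.radius_pos
  have hρ1 := CombClass.lt_one_of_isSubexponential hC
  have hS : 0 < (C.above m).msetSeries ρ := Real.exp_pos _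
  -- The indices as functions of `r = n - m * N` and `N`.
  have hr : Tendsto (fun i => (n i - m * N i, N i)) l (atTop ×ˢ atTop) := by
    refine Tendsto.prodMk ?_ hN
    refine tendsto_atTop.2 fun b => (hnN.eventually (eventually_ge_atTop (b : ℤ))).mono fun i hi => ?_
    have : ((m * N i : ℕ) : ℤ) = (m : ℤ) * N i := by push_cast; rfl
    omega
  have heq : ∀ᶠ i in l, n i - m * N i + m * N i = n i :=
    (hnN.eventually (eventually_ge_atTop 0)).mono fun i hi => by
      have : ((m * N i : ℕ) : ℤ) = (m : ℤ) * N i := by push_cast; rfl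
      omega
  refine ⟨?_, ?_⟩
  -- Only nonemptiness is wanted here, so the empty remainder and a trivial bound suffice.
  · have h0 : (-1 : ℝ) < ρ ^ (C.above m).msize 0 / (C.above m).msetSeries ρ :=
      neg_one_lt_zero.trans_le (by positivity)
    filter_upwards [hr.eventually (CombClass.eventually_lt_remainderLaw hC hm hpick 0 h0), heq]
      with i hi hi'
    simpa only [hi'] using hi.1
  have hsum : HasSum (fun H : (C.above m).Mset => ρ ^ (C.above m).msize H) _ :=
    CombClass.hasSum_pow_msize hρ.le hρ1 (CombClass.hasSum_count_above hm hρ hC.summable).summable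
  have hsum1 := hsum.div_const ((C.above m).msetSeries ρ)
  rw [div_self hS.ne'] at hsum1
  have hnn : ∀ H : (C.above m).Mset, 0 ≤ ρ ^ (C.above m).msize H / (C.above m).msetSeries ρ :=
    fun H => by positivity
  let p : PMF (C.above m).Mset :=
    ⟨fun H => ENNReal.ofReal (ρ ^ (C.above m).msize H / (C.above m).msetSeries ρ), by
      rw [ENNReal.summable.hasSum_iff, ← ENNReal.ofReal_tsum_of_nonneg hnn hsum1.summable,
        hsum1.tsum_eq, ENNReal.ofReal_one]⟩
  have hp : ∀ H, p H = ENNReal.ofReal (ρ ^ (C.above m).msize H / (C.above m).msetSeries ρ) :=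
    fun H => rfl
  let P : ProbabilityMeasure (C.above m).Mset := ⟨p.toMeasure, inferInstance⟩
  have hP : (C.above m).IsBoltzmann ρ P := fun G => by
    change p.toMeasure.real {G} = _
    rw [Measure.real, p.toMeasure_apply_singleton _ MeasurableSet.of_discrete, hp,
      ENNReal.toReal_ofReal (hnn G)]
  refine ⟨P, hP, fun G => ?_, ?_⟩
  · rw [hP G, CombClass.msize_map_ofAbove, CombClass.msetSeries, Real.exp_neg, div_eq_inv_mul]
    congr 1
    · congr 2
      refine tsum_congr fun j => ?_
      have hj : Summable fun k => (C.count k : ℝ) * (ρ ^ (j + 1)) ^ k :=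
        Summable.of_nonneg_of_le (fun k => by positivity) (fun k => by
          have : ρ ^ (j + 1) ≤ ρ := pow_le_of_le_one hρ.le hρ1.le j.succ_ne_zero
          gcongr) hC.summable
      rw [CombClass.genSeries, (CombClass.hasSum_count_above hm (pow_pos hρ _) hj).tsum_eq,
        ← pow_mul, div_div, mul_comm (ρ ^ _)]
    · rw [← zpow_natCast]
      congr 1
      push_cast
      ring
  · have hlim : Tendsto (fun q : ℕ × ℕ => C.remainderLaw m pick (q.1 + m * q.2) q.2)
        (atTop ×ˢ atTop) (𝓝 P) := by
      refine p.tendsto_toMeasure_of_forall_lt rfl fun H b hb => ?_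
      have hbt : b ≠ ∞ := ne_top_of_lt hb
      rw [hp, ENNReal.lt_ofReal_iff_toReal_lt hbt] at hb
      refine (CombClass.eventually_lt_remainderLaw hC hm hpick H hb).mono fun q hq => ?_
      exact (ENNReal.toReal_lt_toReal hbt (measure_ne_top _ _)).1 hq.2
    refine (hlim.comp hr).congr' ?_
    filter_upwards [heq] with i hi
    simp only [Function.comp_apply, hi]
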